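/- For a regular ideal $I$ of a Noetherian commutative ring $R$ (that is, $I$ contains a non-zero-divisor), let $\widetilde{I}=\bigcup_{n\ge 1}(I^{n+1}:_R I^n)$ be its Ratliff--Rush closure, and let $$h(I)=\min\{n\ge 1 \mid I^m=\widetilde{I^m}\ \text{ for all } m\ge n\}.$$ An element $x\in I$ is a principal reduction of $I$ if $I^{n+1}=xI^n$ for some $n\ge 0$; the reduction number of $I$ is $r(I)=\min\{n\ge 0\mid I^{n+1}=xI^n\}$, provided that a principal reduction $x$ exists and that this minimum is the same for all principal reductions $x$ of $I$. For a field $k$ and a submonoid $S$ of $(\mathbb N,+)$, let $k[[S]]\subseteq k[[t]]$ be the ring of power series all of whose exponents lie in $S$. Let $k$ be a field. For every integer $n\ge 3$ put $c_h=(n+h)(2n-1)+1$ for $3\le h\le n$, $$S_n=\langle 2n,\ 4n-1,\ n(2n-1),\ c_3,\dots,c_n\rangle,\qquad E_n=\{2n,\ 4n-1,\ c_3,\dots,c_n\}+S_n,$$ and let $I_n=(t^x : x\in E_n)\subseteq k[[S_n]]$. Then $S_n$ is a numerical semigroup (it has finite complement in $\mathbb N$), the reduction number $r(I_n)$ exists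 and equals $n-1$, and $h(I_n)=1$. Consequently, $h(I)=1$ is possible with $r(I)$ arbitrarily large: for every $N$ there are a one-dimensional Noetherian local ring $R$ with residue field isomorphic to $k$ whose maximal ideal contains a non-zero-divisor, and a regular ideal $I$ of $R$ that has a reduction number, such that $h(I)=1$ and $r(I)\ge N$. -/

import Mathlib

open scoped Pointwise PowerSeries

universe u

/-- The Ratliff-Rush closure of an ideal `I`: the union over `n ≥ 1` of the colon ideals
`(I ^ (n + 1) : I ^ n)` (an increasing chain, so the union is an ideal). -/
def ratliffRush {R : Type*} [CommRing R] (I : Ideal R) : Ideal R where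
  carrier := {r | ∃ n : ℕ, 1 ≤ n ∧ r ∈ (I ^ (n + 1)).colon ((I ^ n : Ideal R) : Set R)}
  zero_mem' := ⟨1, le_rfl, Submodule.zero_mem _⟩
  smul_mem' := by
    rintro c r ⟨n, hn, hr⟩
    exact ⟨n, hn, Submodule.smul_mem _ c hr⟩
  add_mem' := by
    have step : ∀ (r : R) (n d : ℕ), r ∈ (I ^ (n + 1)).colon ((I ^ n : Ideal R) : Set R) →
        r ∈ (I ^ (n + d + 1)).colon ((I ^ (n + d) : Ideal R) : Set R) := by
      intro r n d h
      have h1 : Ideal.span {r} * I ^ n ≤ I ^ (n + 1) := by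
        rw [Ideal.span_singleton_mul_le_iff]
        exact fun z hz => Submodule.mem_colon.mp h z hz
      have h2 : Ideal.span {r} * I ^ (n + d) ≤ I ^ (n + d + 1) := by
        calc Ideal.span {r} * I ^ (n + d) = (Ideal.span {r} * I ^ n) * I ^ d := by ring
          _ ≤ I ^ (n + 1) * I ^ d := Ideal.mul_mono_left h1
          _ = I ^ (n + d + 1) := by ring
      rw [Ideal.span_singleton_mul_le_iff] at h2
      exact Submodule.mem_colon.mpr h2
    rintro r s ⟨n, hn, hr⟩ ⟨m, _, hs⟩
    refine ⟨n + m, by omega, Submodule.add_mem _ (step r n m hr) ?_⟩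
    have := step s m n hs
    rwa [Nat.add_comm m n] at this

/-- The asymptotic Ratliff-Rush number
`h(I) = min {n ≥ 1 | I ^ m equals its Ratliff-Rush closure for all m ≥ n}`. -/
noncomputable def ratliffRushNumber {R : Type*} [CommRing R] (I : Ideal R) : ℕ :=
  sInf {n : ℕ | 1 ≤ n ∧ ∀ m : ℕ, n ≤ m → I ^ m = ratliffRush (I ^ m)}

/-- `x` generates a principal reduction of `I`. -/
def IsPrincipalReduction {R : Type*} [CommRing R] (I : Ideal R) (x : R) : Prop :=
  x ∈ I ∧ ∃ n : ℕ, I ^ (n + 1) = Ideal.span {x} * I ^ n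

/-- `r(I) = r`: the ideal `I` has a principal reduction, and
`r = min {n | I ^ (n + 1) = x I ^ n}` for every principal reduction `x` of `I`. -/
def HasReductionNumber {R : Type*} [CommRing R] (I : Ideal R) (r : ℕ) : Prop :=
  (∃ x : R, IsPrincipalReduction I x) ∧
    ∀ x : R, IsPrincipalReduction I x →
      IsLeast {n : ℕ | I ^ (n + 1) = Ideal.span {x} * I ^ n} r

/-- The semigroup ring `k[[S]]`: the power series all of whose exponents lie in `S`. -/
def semigroupRing (k : Type*) [Field k] (S : AddSubmonoid ℕ) : Subalgebra k k⟦X⟧ where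
  carrier := {f | ∀ i : ℕ, PowerSeries.coeff i f ≠ 0 → i ∈ S}
  mul_mem' := by
    intro f g hf hg i hi
    rw [PowerSeries.coeff_mul] at hi
    obtain ⟨p, hp, hne⟩ := Finset.exists_ne_zero_of_sum_ne_zero hi
    rw [← Finset.HasAntidiagonal.mem_antidiagonal.mp hp]
    exact S.add_mem (hf _ (left_ne_zero_of_mul hne)) (hg _ (right_ne_zero_of_mul hne))
  add_mem' := by
    intro f g hf hg i hi
    by_cases h : PowerSeries.coeff i f = 0
    · exact hg i fun h' => hi (by rw [map_add, h, h', add_zero])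
    · exact hf i h
  algebraMap_mem' := by
    intro c i hi
    by_cases h : i = 0
    · rw [h]
      exact S.zero_mem
    · refine absurd ?_ hi
      rw [PowerSeries.algebraMap_apply, PowerSeries.coeff_C]
      simp [h]

/-- The monomial ideal `(t ^ x : x ∈ E)` of `k[[S]]`. -/
noncomputable def monomialIdeal (k : Type*) [Field k] (S : AddSubmonoid ℕ) (E : Set ℕ) :
    Ideal (semigroupRing k S) :=
  Ideal.span {f | ∃ x ∈ E, (f : k⟦X⟧) = PowerSeries.X ^ x}

/-- The elements `c_3, …, c_n`, where `c_h = (n + h)(2n - 1) + 1`. -/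
def cSet (n : ℕ) : Set ℕ :=
  {c | ∃ h : ℕ, 3 ≤ h ∧ h ≤ n ∧ c = (n + h) * (2 * n - 1) + 1}

/-- The semigroup `S_n = ⟨2n, 4n - 1, n(2n - 1), c_3, …, c_n⟩`. -/
def semigroupS (n : ℕ) : AddSubmonoid ℕ :=
  AddSubmonoid.closure ({2 * n, 4 * n - 1, n * (2 * n - 1)} ∪ cSet n)

/-- The semigroup ideal `E_n = {2n, 4n - 1, c_3, …, c_n} + S_n`. -/
def idealE (n : ℕ) : Set ℕ :=
  ({2 * n, 4 * n - 1} ∪ cSet n) + (semigroupS n : Set ℕ)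

/-!
Put `p = 2 * n - 1`. The generators of `S_n` are `1 * p + 1`, `2 * p + 1`, `(n + h) * p + 1` for
`3 ≤ h ≤ n`, and `n * p`; all but the last generate `E_n`. Give `x * p + j` the degree `j`. The
elements of degree `j` obtained from the generators are the `x * p + j` with `x` in

  `T_0 = n ℕ`,  `T_j = [j, 2j] ∪ [n + j, ∞)` for `j ≥ 1`  (`degreePart`),

and `E_n + ⋯ + E_n` (`m` summands) consists of the `x * p + j` with `j ≥ m` and `x ∈ T_j`
(`levelSet`); the same description with `m = 0` gives `S_n`. A number can have several
representations, which differ by multiples of `(-1, p)`.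

* There is no gap in `T_j` exactly when `j ≥ n - 1`, and then `T_j = [j, ∞)`. Hence
  `(j + 1) E_n = 2 n + j E_n` for `j ≥ n - 1` (`exists_of_mem_levelSet_succ`), while for smaller `j`
  the number `(j + 1) * (4 * n - 1)` lies only in the left-hand side (`not_mem_levelSet_of_lt`).
* If `s ∈ S_n` and `s + l * (2 * n) ∈ (l + m) E_n`, then `s ∈ m E_n`
  (`mem_levelSet_of_add_mul_mem`): a representation of `s + l * (2 * n)` either has degree at most
  `l` plus that of the given representation of `s`, or exceeds it by at least `p`, and then
  subtracting `(l, l)` from it gives a representation of `s` of degree at least `n - 1`.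

Since `S_n` has finite complement, `I_n ^ m` is the ideal of all series supported on `m E_n`
(`mem_monomialIdeal_idealE_pow_iff`). The second point therefore says that each `I_n ^ m` is
Ratliff-Rush closed. For the reduction number, a principal reduction `x` of `I_n` must have order
`2 * n`, and dividing a series by `x` moves its support as dividing by `t ^ (2 * n)` would
(`mem_of_coeff_ne_zero_of_mul`), so that the first point decides when `I_n ^ (j + 1) = x I_n ^ j`,
independently of `x`.

For the ring `k[[S]]`, with `S` of finite complement: a series is a unit if and only if its constant
coefficient is nonzero, so the ring is local with residue field `k`; every nonzero `x` divides each
element of `k[[S]]` of large order, so the only nonzero prime ideal is the maximal ideal, and this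
one is finitely generated. Cohen's theorem gives noetherianity, and the dimension is one.
-/

/-! ### The graded pieces of the semigroup -/

/-- The set of `x` for which `x * (2 * n - 1) + j` is a sum of `j` of the generators
`2 * n, 4 * n - 1, c_3, …, c_n` and a multiple of `n * (2 * n - 1)`. -/
def degreePart (n j : ℕ) : Set ℕ :=
  {x | (j = 0 ∧ n ∣ x) ∨ (1 ≤ j ∧ ((j ≤ x ∧ x ≤ 2 * j) ∨ n + j ≤ x))}

/-- The integers having a representation `x * (2 * n - 1) + j` of degree `j ≥ m`. -/
def levelSet (n m : ℕ) : Set ℕ :=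
  {z | ∃ x j, m ≤ j ∧ x ∈ degreePart n j ∧ z = x * (2 * n - 1) + j}

theorem le_of_mem_degreePart {n j x : ℕ} (h : x ∈ degreePart n j) : j ≤ x := by
  rcases h with h | h <;> omega

theorem mem_degreePart_of_le {n j x : ℕ} (hn : 2 ≤ n) (hj : n - 1 ≤ j) (h : j ≤ x) :
    x ∈ degreePart n j := by
  refine Or.inr ?_
  omega

theorem add_mem_degreePart {n i j x y : ℕ} (hx : x ∈ degreePart n i) (hy : y ∈ degreePart n j) :
    x + y ∈ degreePart n (i + j) := by
  rcases hx with ⟨rfl, hx⟩ | hx <;> rcases hy with ⟨rfl, hy⟩ | hy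
  · exact Or.inl ⟨rfl, dvd_add hx hy⟩
  · refine Or.inr ?_
    rcases Nat.eq_zero_or_pos x with rfl | h0
    · omega
    · have := Nat.le_of_dvd h0 hx
      omega
  · refine Or.inr ?_
    rcases Nat.eq_zero_or_pos y with rfl | h0
    · omega
    · have := Nat.le_of_dvd h0 hy
      omega
  · refine Or.inr ?_
    omega

theorem exists_of_mem_degreePart_succ {n j x : ℕ} (hx : x ∈ degreePart n (j + 1)) :
    ∃ y ∈ degreePart n j, ∃ w ∈ degreePart n 1, x = y + w := by
  rcases Nat.eq_zero_or_pos j with rfl | hj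
  · exact ⟨0, Or.inl ⟨rfl, dvd_zero n⟩, x, hx, (zero_add x).symm⟩
  · rcases hx with hx | hx
    · omega
    · by_cases h : x = 2 * (j + 1)
      · -- only here `x - 1 = 2 * j + 1` may fall into the gap of `degreePart n j`
        exact ⟨2 * j, Or.inr (by omega), 2, Or.inr (by omega), by omega⟩
      · exact ⟨x - 1, Or.inr (by omega), 1, Or.inr (by omega), by omega⟩

/-- Every residue class modulo `n` contains exactly one of `1`, `2`, `n + 3`, …, `n + n`, the
least element of `degreePart n 1` in that class. -/
theorem exists_of_mem_degreePart_one {n w : ℕ} (hn : 3 ≤ n) (hw : w ∈ degreePart n 1) :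
    ∃ q v, w = q * n + v ∧ (v = 1 ∨ v = 2 ∨ ∃ h, 3 ≤ h ∧ h ≤ n ∧ v = n + h) := by
  have h1 : 1 ≤ w := le_of_mem_degreePart hw
  obtain ⟨q, s, hs, hw'⟩ : ∃ q s, s < n ∧ w = n * q + s + 1 :=
    ⟨(w - 1) / n, (w - 1) % n, Nat.mod_lt _ (by omega), by
      have := Nat.div_add_mod (w - 1) n
      omega⟩
  by_cases h2 : s ≤ 1
  · exact ⟨q, s + 1, by rw [hw']; ring, by omega⟩
  · rcases q with _ | q
    · rcases hw with hw | hw <;> omega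
    · refine ⟨q, n + (s + 1), by rw [hw']; ring, Or.inr (Or.inr ⟨s + 1, by omega, by omega, rfl⟩)⟩

theorem add_mem_levelSet {n i j y z : ℕ} (hy : y ∈ levelSet n i) (hz : z ∈ levelSet n j) :
    y + z ∈ levelSet n (i + j) := by
  obtain ⟨x, a, ha, hx, rfl⟩ := hy
  obtain ⟨w, b, hb, hw, rfl⟩ := hz
  exact ⟨x + w, a + b, by omega, add_mem_degreePart hx hw, by ring⟩

theorem levelSet_antitone (n : ℕ) : Antitone (levelSet n) := by
  rintro i j hij z ⟨x, a, ha, hx⟩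
  exact ⟨x, a, hij.trans ha, hx⟩

theorem levelSet_succ (n m : ℕ) : levelSet n (m + 1) = levelSet n m + levelSet n 1 := by
  apply Set.Subset.antisymm
  · rintro z ⟨x, _ | j, hj, hx, rfl⟩
    · omega
    · obtain ⟨y, hy, w, hw, rfl⟩ := exists_of_mem_degreePart_succ hx
      exact Set.mem_add.mpr ⟨_, ⟨y, j, by omega, hy, rfl⟩, _, ⟨w, 1, le_rfl, hw, rfl⟩, by ring⟩
  · rintro z ⟨y, hy, w, hw, rfl⟩
    exact add_mem_levelSet hy hw

theorem two_mul_mem_levelSet {n : ℕ} (hn : 3 ≤ n) : 2 * n ∈ levelSet n 1 :=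
  ⟨1, 1, le_rfl, Or.inr (by omega), by omega⟩

theorem mul_two_mul_mem_levelSet {n : ℕ} (hn : 3 ≤ n) (m : ℕ) : m * (2 * n) ∈ levelSet n m := by
  induction m with
  | zero => exact ⟨0, 0, le_rfl, Or.inl ⟨rfl, dvd_zero n⟩, by simp⟩
  | succ m ih =>
    rw [Nat.succ_mul]
    exact add_mem_levelSet ih (two_mul_mem_levelSet hn)

theorem le_of_mem_levelSet {n m z : ℕ} (hn : 3 ≤ n) (hz : z ∈ levelSet n m) :
    m * (2 * n) ≤ z := by
  obtain ⟨x, j, hj, hx, rfl⟩ := hz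
  obtain ⟨p, hp⟩ : ∃ p, 2 * n = p + 1 := ⟨2 * n - 1, by omega⟩
  have h1 := le_of_mem_degreePart hx
  rw [hp, Nat.add_sub_cancel, Nat.mul_add, mul_one]
  exact add_le_add (Nat.mul_le_mul_right p (hj.trans h1)) hj

theorem subset_levelSet_one {n : ℕ} (hn : 3 ≤ n) :
    ({2 * n, 4 * n - 1} ∪ cSet n : Set ℕ) ⊆ levelSet n 1 := by
  rintro z ((rfl | rfl) | ⟨h, h3, hh, rfl⟩)
  · exact two_mul_mem_levelSet hn
  · exact ⟨2, 1, le_rfl, Or.inr (by omega), by omega⟩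
  · exact ⟨n + h, 1, le_rfl, Or.inr (by omega), rfl⟩

theorem exists_generator_of_mem_degreePart_one {n w : ℕ} (hn : 3 ≤ n) (hw : w ∈ degreePart n 1) :
    ∃ q, ∃ g ∈ ({2 * n, 4 * n - 1} ∪ cSet n : Set ℕ),
      w * (2 * n - 1) + 1 = g + q * (n * (2 * n - 1)) := by
  obtain ⟨q, v, rfl, hv⟩ := exists_of_mem_degreePart_one hn hw
  refine ⟨q, v * (2 * n - 1) + 1, ?_, by ring⟩
  rcases hv with rfl | rfl | ⟨h, h3, hh, rfl⟩
  · exact Or.inl (Or.inl (by omega))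
  · exact Or.inl (Or.inr (show _ = _ by omega))
  · exact Or.inr ⟨h, h3, hh, rfl⟩

theorem mem_semigroupS_of_mem {n z : ℕ} (hz : z ∈ ({2 * n, 4 * n - 1} ∪ cSet n : Set ℕ)) :
    z ∈ semigroupS n := by
  apply AddSubmonoid.subset_closure
  rcases hz with (rfl | rfl) | h
  · simp
  · simp
  · exact Or.inr h

theorem mul_generator_mem_semigroupS (n q : ℕ) : q * (n * (2 * n - 1)) ∈ semigroupS n := by
  rw [← smul_eq_mul]
  exact AddSubmonoid.nsmul_mem _ (AddSubmonoid.subset_closure (by simp)) q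

theorem coe_semigroupS {n : ℕ} (hn : 3 ≤ n) : (semigroupS n : Set ℕ) = levelSet n 0 := by
  apply Set.Subset.antisymm
  · intro z hz
    induction hz using AddSubmonoid.closure_induction with
    | mem z hz =>
      by_cases h : z = n * (2 * n - 1)
      · exact ⟨n, 0, le_rfl, Or.inl ⟨rfl, dvd_rfl⟩, h⟩
      · apply levelSet_antitone n zero_le_one
        apply subset_levelSet_one hn
        rcases hz with (rfl | rfl | rfl) | h'
        · simp
        · simp
        · exact absurd rfl h
        · exact Or.inr h'
    | zero => exact ⟨0, 0, le_rfl, Or.inl ⟨rfl, dvd_zero n⟩, by simp⟩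
    | add y z _ _ hy hz => exact add_mem_levelSet hy hz
  · rintro z ⟨x, j, -, hx, rfl⟩
    induction j generalizing x with
    | zero =>
      rcases hx with ⟨-, q, rfl⟩ | hx
      · rw [SetLike.mem_coe, add_zero, mul_comm n q, mul_assoc]
        exact mul_generator_mem_semigroupS n q
      · omega
    | succ j ih =>
      obtain ⟨y, hy, w, hw, rfl⟩ := exists_of_mem_degreePart_succ hx
      obtain ⟨q, g, hg, hw'⟩ := exists_generator_of_mem_degreePart_one hn hw
      have : (y + w) * (2 * n - 1) + (j + 1)
          = (y * (2 * n - 1) + j) + (g + q * (n * (2 * n - 1))) := by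
        rw [← hw']; ring
      rw [this]
      exact add_mem (ih y hy) (add_mem (mem_semigroupS_of_mem hg) (mul_generator_mem_semigroupS n q))

theorem idealE_eq_levelSet {n : ℕ} (hn : 3 ≤ n) : idealE n = levelSet n 1 := by
  apply Set.Subset.antisymm
  · rintro _ ⟨g, hg, s, hs, rfl⟩
    rw [coe_semigroupS hn] at hs
    exact add_mem_levelSet (i := 1) (j := 0) (subset_levelSet_one hn hg) hs
  · rintro _ ⟨x, _ | j, hj, hx, rfl⟩
    · omega
    · obtain ⟨y, hy, w, hw, rfl⟩ := exists_of_mem_degreePart_succ hx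
      obtain ⟨q, g, hg, hw'⟩ := exists_generator_of_mem_degreePart_one hn hw
      refine Set.mem_add.mpr ⟨g, hg, q * (n * (2 * n - 1)) + (y * (2 * n - 1) + j), ?_, ?_⟩
      · apply add_mem (mul_generator_mem_semigroupS n q)
        rw [← SetLike.mem_coe, coe_semigroupS hn]
        exact ⟨y, j, Nat.zero_le j, hy, rfl⟩
      · have : (y + w) * (2 * n - 1) + (j + 1)
          = (y * (2 * n - 1) + j) + (w * (2 * n - 1) + 1) := by ring
        rw [this, hw']; ring

theorem exists_forall_ge_mem_semigroupS {n : ℕ} (hn : 3 ≤ n) :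
    ∃ c, ∀ i, c ≤ i → i ∈ semigroupS n := by
  refine ⟨(2 * (2 * n - 1) + 1) * (2 * n - 1), fun i hi => ?_⟩
  rw [← SetLike.mem_coe, coe_semigroupS hn]
  have hp : 0 < 2 * n - 1 := by omega
  have h1 := Nat.div_add_mod i (2 * n - 1)
  have h2 := Nat.mod_lt i hp
  have h3 := (Nat.le_div_iff_mul_le hp).mpr hi
  -- `i` is written with the positive degree `i % (2 * n - 1) + (2 * n - 1)`
  refine ⟨i / (2 * n - 1) - 1, i % (2 * n - 1) + (2 * n - 1), Nat.zero_le _,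
    mem_degreePart_of_le (by omega) (by omega) (by omega), ?_⟩
  obtain ⟨q, hq⟩ : ∃ q, i / (2 * n - 1) = q + 1 := ⟨i / (2 * n - 1) - 1, by omega⟩
  rw [hq] at h1 ⊢
  rw [Nat.add_sub_cancel]
  linarith

/-- The initial form of `t ^ (2 * n)` is a nonzerodivisor on the associated graded ring of `E_n`, in
terms of exponents. This is what makes all powers of `I_n` Ratliff-Rush closed. -/
theorem mem_levelSet_of_add_mul_mem {n m l s : ℕ} (hn : 3 ≤ n) (hs : s ∈ levelSet n 0)
    (h : s + l * (2 * n) ∈ levelSet n (l + m)) : s ∈ levelSet n m := by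
  obtain ⟨x, j, -, hx, rfl⟩ := hs
  obtain ⟨y, i, hi, hy, h⟩ := h
  have hyi := le_of_mem_degreePart hy
  obtain ⟨p, hp⟩ : ∃ p, 2 * n = p + 1 := ⟨2 * n - 1, by omega⟩
  rw [hp, Nat.add_sub_cancel] at h
  by_cases hij : i ≤ j + l
  · exact ⟨x, j, by omega, hx, rfl⟩
  · -- the two representations differ by a multiple of `(-1, p)`
    have hz : ((x : ℤ) + l - y) * p = i - (j + l) := by
      have : (x * p + j + l * (p + 1) : ℤ) = y * p + i := by exact_mod_cast h
      linarith
    have hp0 : (0 : ℤ) < p := by omega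
    have hpos : 0 < (x : ℤ) + l - y := by
      by_contra hneg
      have := mul_nonpos_of_nonpos_of_nonneg (not_lt.mp hneg) hp0.le
      omega
    have hge : (p : ℤ) ≤ i - (j + l) := by
      rw [← hz]; nlinarith
    refine ⟨y - l, i - l, by omega, mem_degreePart_of_le (by omega) (by omega) (by omega), ?_⟩
    obtain ⟨y', rfl⟩ : ∃ y', y = y' + l := ⟨y - l, by omega⟩
    obtain ⟨i', rfl⟩ : ∃ i', i = i' + l := ⟨i - l, by omega⟩
    rw [hp, Nat.add_sub_cancel, Nat.add_sub_cancel, Nat.add_sub_cancel]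
    linarith

/-- For `j ≥ n - 1` there are no gaps left in `degreePart n j = [j, ∞)`, so that a representation
`(x, i)` may be shifted to `(x - 1, i - 1)`. -/
theorem exists_of_mem_levelSet_succ {n j z : ℕ} (hn : 3 ≤ n) (hj : n - 1 ≤ j)
    (hz : z ∈ levelSet n (j + 1)) : ∃ y ∈ levelSet n j, z = 2 * n + y := by
  obtain ⟨x, i, hi, hx, rfl⟩ := hz
  have := le_of_mem_degreePart hx
  refine ⟨(x - 1) * (2 * n - 1) + (i - 1),
    ⟨x - 1, i - 1, by omega, mem_degreePart_of_le (by omega) (by omega) (by omega), rfl⟩, ?_⟩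
  obtain ⟨p, hp⟩ : ∃ p, 2 * n = p + 1 := ⟨2 * n - 1, by omega⟩
  obtain ⟨x, rfl⟩ : ∃ x', x = x' + 1 := ⟨x - 1, by omega⟩
  obtain ⟨i, rfl⟩ : ∃ i', i = i' + 1 := ⟨i - 1, by omega⟩
  simp only [hp, Nat.add_sub_cancel]
  ring

theorem mul_four_mul_sub_one_mem_levelSet {n : ℕ} (hn : 3 ≤ n) (j : ℕ) :
    (j + 1) * (4 * n - 1) ∈ levelSet n (j + 1) := by
  refine ⟨2 * (j + 1), j + 1, le_rfl, Or.inr (by omega), ?_⟩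
  rw [show 4 * n - 1 = 2 * (2 * n - 1) + 1 by omega]
  ring

theorem not_mem_levelSet_of_lt {n j y : ℕ} (hj : j < n - 1)
    (hy : 2 * n + y = (j + 1) * (4 * n - 1)) : y ∉ levelSet n j := by
  rintro ⟨x, i, hi, hx, rfl⟩
  obtain ⟨p, hp⟩ : ∃ p, 2 * n = p + 1 := ⟨2 * n - 1, by omega⟩
  rw [show 4 * n - 1 = 2 * p + 1 by omega, hp, Nat.add_sub_cancel] at hy
  have hxi := le_of_mem_degreePart hx
  have hz : ((2 * j + 1 : ℤ) - x) * p = i - j := by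
    have : ((p + 1) + (x * p + i) : ℤ) = (j + 1) * (2 * p + 1) := by exact_mod_cast hy
    linarith
  have hp0 : (0 : ℤ) < p := by omega
  have hx2 : x = 2 * j + 1 := by
    have h1 : 0 ≤ (2 * j + 1 : ℤ) - x := by
      by_contra hneg
      nlinarith
    have h2 : (2 * j + 1 : ℤ) - x < 1 := by
      by_contra hpos
      have := mul_nonneg hp0.le (sub_nonneg.mpr (not_lt.mp hpos))
      have : (p : ℤ) ≤ i - j := by linarith
      omega
    omega
  subst hx2
  have : i = j := by
    push_cast at hz
    linarith
  subst this
  rcases hx with hx | hx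
  · obtain ⟨rfl, hd⟩ := hx
    have := Nat.le_of_dvd (by omega) hd
    omega
  · omega

/-! ### Division of power series and supports -/

section Division

variable {k : Type*} [Field k]

/-- If `x` has order `e` and `x * g` is supported on `e + F`, then `g` is supported on `F`, as soon
as adding an exponent of `x` to an element of `F` gives an element of `e + F`. -/
theorem mem_of_coeff_ne_zero_of_mul {x g : k⟦X⟧} {e : ℕ} {F : Set ℕ}
    (hlt : ∀ i < e, PowerSeries.coeff i x = 0) (he : PowerSeries.coeff e x ≠ 0)
    (hF : ∀ i, PowerSeries.coeff i x ≠ 0 → ∀ j ∈ F, ∃ l ∈ F, i + j = e + l)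
    (hmul : ∀ i, PowerSeries.coeff i (x * g) ≠ 0 → ∃ l ∈ F, i = e + l) (i : ℕ)
    (hi : PowerSeries.coeff i g ≠ 0) : i ∈ F := by
  induction i using Nat.strong_induction_on with
  | _ i ih =>
    by_cases h : ∃ q ∈ Finset.HasAntidiagonal.antidiagonal (e + i), q ≠ (e, i) ∧
        PowerSeries.coeff q.1 x * PowerSeries.coeff q.2 g ≠ 0
    · obtain ⟨⟨a, b⟩, hab, hne, h0⟩ := h
      rw [Finset.HasAntidiagonal.mem_antidiagonal] at hab
      dsimp only at hab h0
      have hea : e ≤ a := by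
        by_contra h
        exact left_ne_zero_of_mul h0 (hlt a (not_le.mp h))
      have hea' : e ≠ a := by
        rintro rfl
        exact hne (by rw [Nat.add_left_cancel hab])
      obtain ⟨l, hl, h⟩ := hF a (left_ne_zero_of_mul h0) b
        (ih b (by omega) (right_ne_zero_of_mul h0))
      rwa [show i = l by omega]
    · push Not at h
      obtain ⟨l, hl, h⟩ := hmul (e + i) (by
        rw [PowerSeries.coeff_mul, Finset.sum_eq_single_of_mem (e, i) (by simp) h]
        exact mul_ne_zero he hi)
      rwa [show i = l by omega]

theorem dvd_of_X_pow_dvd {x f : k⟦X⟧} {e : ℕ} (hlt : ∀ i < e, PowerSeries.coeff i x = 0)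
    (he : PowerSeries.coeff e x ≠ 0) (hf : (PowerSeries.X : k⟦X⟧) ^ e ∣ f) : x ∣ f := by
  obtain ⟨u, rfl⟩ := PowerSeries.X_pow_dvd_iff.mpr hlt
  have hu : IsUnit u := by
    rw [PowerSeries.isUnit_iff_constantCoeff, isUnit_iff_ne_zero]
    rwa [PowerSeries.coeff_X_pow_mul', if_pos le_rfl, Nat.sub_self,
      PowerSeries.coeff_zero_eq_constantCoeff_apply] at he
  exact hu.mul_right_dvd.mpr hf

end Division

/-! ### Semigroup rings and their monomial ideals -/

section SemigroupRing

variable {k : Type*} [Field k] {S : AddSubmonoid ℕ}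

theorem X_pow_mem_semigroupRing {i : ℕ} (hi : i ∈ S) :
    (PowerSeries.X : k⟦X⟧) ^ i ∈ semigroupRing k S := by
  intro j hj
  rw [PowerSeries.coeff_X_pow] at hj
  rwa [of_not_not fun h => hj (if_neg h)]

/-- The monomial `t ^ i`, for `i ∈ S`, as an element of `k[[S]]`. -/
noncomputable def semigroupRing.monomial (k : Type*) [Field k] {i : ℕ} (hi : i ∈ S) :
    semigroupRing k S :=
  ⟨PowerSeries.X ^ i, X_pow_mem_semigroupRing hi⟩

theorem semigroupRing.coe_monomial {i : ℕ} (hi : i ∈ S) :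
    (semigroupRing.monomial k hi : k⟦X⟧) = PowerSeries.X ^ i :=
  rfl

theorem coeff_ne_zero_mem_of_mem_monomialIdeal {E : Set ℕ} (hES : E + (S : Set ℕ) ⊆ E)
    {f : semigroupRing k S} (hf : f ∈ monomialIdeal k S E) (i : ℕ)
    (hi : PowerSeries.coeff i (f : k⟦X⟧) ≠ 0) : i ∈ E := by
  induction hf using Submodule.span_induction generalizing i with
  | mem f hf =>
    obtain ⟨x, hx, hfx⟩ := hf
    rw [hfx, PowerSeries.coeff_X_pow] at hi
    rwa [of_not_not fun h => hi (if_neg h)]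
  | zero => exact absurd (map_zero _) hi
  | add f g _ _ hf hg =>
    by_cases h : PowerSeries.coeff i (f : k⟦X⟧) = 0
    · refine hg i fun h' => hi ?_
      rw [AddMemClass.coe_add, map_add, h, h', add_zero]
    · exact hf i h
  | smul a f _ hf =>
    rw [smul_eq_mul, MulMemClass.coe_mul, PowerSeries.coeff_mul] at hi
    obtain ⟨q, hq, hne⟩ := Finset.exists_ne_zero_of_sum_ne_zero hi
    rw [← Finset.HasAntidiagonal.mem_antidiagonal.mp hq, add_comm]
    exact hES (Set.add_mem_add (hf _ (right_ne_zero_of_mul hne)) (a.2 _ (left_ne_zero_of_mul hne)))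

/-- A series supported on the `S`-ideal `E` is already a combination of the monomials `t ^ x`,
`x ∈ E`, with `x ≤ e + c`, where `e ∈ E` and `c` is past all gaps of `S`: the terms of exponent at
least `e + c` form a multiple of `t ^ e`. -/
theorem mem_span_of_coeff_ne_zero_mem {E : Set ℕ} (hE : E ⊆ S) {c e : ℕ}
    (hc : ∀ i, c ≤ i → i ∈ S) (he : e ∈ E) (f : semigroupRing k S)
    (hf : ∀ i, PowerSeries.coeff i (f : k⟦X⟧) ≠ 0 → i ∈ E) :
    f ∈ Ideal.span {f : semigroupRing k S |
      ∃ x ∈ E, x ≤ e + c ∧ (f : k⟦X⟧) = PowerSeries.X ^ x} := by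
  -- downward induction on a lower bound for the order of `f`
  suffices H : ∀ d ≤ e + c, ∀ f : semigroupRing k S,
      (∀ i, PowerSeries.coeff i (f : k⟦X⟧) ≠ 0 → i ∈ E) →
      (∀ i < e + c - d, PowerSeries.coeff i (f : k⟦X⟧) = 0) →
      f ∈ Ideal.span {f : semigroupRing k S |
        ∃ x ∈ E, x ≤ e + c ∧ (f : k⟦X⟧) = PowerSeries.X ^ x} from
    H (e + c) le_rfl f hf fun i hi => by omega
  intro d
  induction d with
  | zero =>
    intro _ f _ h0
    obtain ⟨g, hg⟩ := PowerSeries.X_pow_dvd_iff.mpr h0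
    rw [Nat.sub_zero, pow_add, mul_assoc] at hg
    have hgS : PowerSeries.X ^ c * g ∈ semigroupRing k S := by
      intro i hi
      rw [PowerSeries.coeff_X_pow_mul'] at hi
      exact hc i (of_not_not fun h => hi (if_neg h))
    have : f = ⟨_, hgS⟩ * semigroupRing.monomial k (hE he) := by
      apply Subtype.ext
      rw [MulMemClass.coe_mul, semigroupRing.coe_monomial, hg, mul_comm]
    rw [this]
    exact Ideal.mul_mem_left _ _ (Ideal.subset_span ⟨e, he, by omega, rfl⟩)
  | succ d ih =>
    intro hd f hf h0
    by_cases hN : PowerSeries.coeff (e + c - (d + 1)) (f : k⟦X⟧) = 0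
    · refine ih (by omega) f hf fun i hi => ?_
      by_cases h : i = e + c - (d + 1)
      · rw [h, hN]
      · exact h0 i (by omega)
    · have hNE := hf _ hN
      set N := e + c - (d + 1) with hNdef
      set a := PowerSeries.coeff N (f : k⟦X⟧) with ha
      set m : semigroupRing k S :=
        algebraMap k _ a * semigroupRing.monomial k (hE hNE) with hm
      have hcoeff : ∀ i, PowerSeries.coeff i ((f - m : semigroupRing k S) : k⟦X⟧) =
          if i = N then 0 else PowerSeries.coeff i (f : k⟦X⟧) := by
        intro i
        have h1 : ((f - m : semigroupRing k S) : k⟦X⟧) =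
            (f : k⟦X⟧) - PowerSeries.C a * PowerSeries.X ^ N := rfl
        rw [h1, map_sub, PowerSeries.coeff_C_mul, PowerSeries.coeff_X_pow]
        split_ifs with h
        · rw [h, ← ha]; ring
        · ring
      rw [← sub_add_cancel f m]
      refine Ideal.add_mem _ (ih (by omega) _ (fun i hi => ?_) fun i hi => ?_)
        (Ideal.mul_mem_left _ _ (Ideal.subset_span ⟨N, hNE, by omega, rfl⟩))
      · rw [hcoeff] at hi
        split_ifs at hi with h
        · exact absurd rfl hi
        · exact hf i hi
      · rw [hcoeff]
        split_ifs with h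
        · rfl
        · exact h0 i (by omega)

/-- When `S` has finite complement, a nonzero monomial ideal consists of all series supported on its
exponents, infinite ones included, because it is finitely generated. -/
theorem mem_monomialIdeal_iff {E : Set ℕ} (hES : E + (S : Set ℕ) ⊆ E) (hE : E ⊆ S)
    (hS : ∃ c, ∀ i, c ≤ i → i ∈ S) (hne : E.Nonempty) {f : semigroupRing k S} :
    f ∈ monomialIdeal k S E ↔ ∀ i, PowerSeries.coeff i (f : k⟦X⟧) ≠ 0 → i ∈ E := by
  refine ⟨coeff_ne_zero_mem_of_mem_monomialIdeal hES, fun hf => ?_⟩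
  obtain ⟨c, hc⟩ := hS
  obtain ⟨e, he⟩ := hne
  refine Ideal.span_mono ?_ (mem_span_of_coeff_ne_zero_mem hE hc he f hf)
  rintro f ⟨x, hx, -, hfx⟩
  exact ⟨x, hx, hfx⟩

theorem monomialIdeal_mul {E F : Set ℕ} (hE : E ⊆ S) (hF : F ⊆ S) :
    monomialIdeal k S E * monomialIdeal k S F = monomialIdeal k S (E + F) := by
  rw [monomialIdeal, monomialIdeal, Ideal.span_mul_span', monomialIdeal]
  congr 1
  ext f
  constructor
  · rintro ⟨a, ⟨x, hx, hax⟩, b, ⟨y, hy, hby⟩, rfl⟩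
    refine ⟨x + y, Set.add_mem_add hx hy, ?_⟩
    rw [pow_add, ← hax, ← hby]
    rfl
  · rintro ⟨_, ⟨x, hx, y, hy, rfl⟩, hf⟩
    refine ⟨semigroupRing.monomial k (hE hx), ⟨x, hx, rfl⟩,
      semigroupRing.monomial k (hF hy), ⟨y, hy, rfl⟩, Subtype.ext ?_⟩
    rw [hf]
    exact (pow_add _ _ _).symm

theorem isUnit_semigroupRing_iff {f : semigroupRing k S} :
    IsUnit f ↔ PowerSeries.constantCoeff (f : k⟦X⟧) ≠ 0 := by
  constructor
  · intro h
    exact (h.map ((PowerSeries.constantCoeff (R := k)).comp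
      (semigroupRing k S).val.toRingHom)).ne_zero
  · intro h
    obtain ⟨g, hg⟩ :=
      (PowerSeries.isUnit_iff_constantCoeff.mpr (isUnit_iff_ne_zero.mpr h)).exists_right_inv
    have hgS : g ∈ semigroupRing k S := by
      refine mem_of_coeff_ne_zero_of_mul (e := 0) (F := S) (x := (f : k⟦X⟧))
        (fun i hi => absurd hi (Nat.not_lt_zero i)) ?_ ?_ ?_
      · rwa [PowerSeries.coeff_zero_eq_constantCoeff_apply]
      · intro i hi j hj
        exact ⟨i + j, S.add_mem (f.2 i hi) hj, (zero_add _).symm⟩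
      · intro i hi
        rw [hg, PowerSeries.coeff_one] at hi
        rw [of_not_not fun h => hi (if_neg h)]
        exact ⟨0, S.zero_mem, rfl⟩
    exact IsUnit.of_mul_eq_one ⟨g, hgS⟩ (Subtype.ext hg)

/-- The constant coefficient of `k[[S]]`, which identifies its residue field with `k`. -/
noncomputable def semigroupRing.residueMap (k : Type*) [Field k] (S : AddSubmonoid ℕ) :
    semigroupRing k S →+* k :=
  (PowerSeries.constantCoeff (R := k)).comp (semigroupRing k S).val.toRingHom

theorem semigroupRing.residueMap_surjective :
    Function.Surjective (semigroupRing.residueMap k S) :=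
  fun a => ⟨algebraMap k _ a, PowerSeries.constantCoeff_C a⟩

instance : IsLocalHom (semigroupRing.residueMap k S) :=
  ⟨fun _ hf => isUnit_semigroupRing_iff.mpr hf.ne_zero⟩

instance : IsLocalRing (semigroupRing k S) :=
  (semigroupRing.residueMap k S).domain_isLocalRing

theorem mem_maximalIdeal_semigroupRing_iff {f : semigroupRing k S} :
    f ∈ IsLocalRing.maximalIdeal (semigroupRing k S) ↔
      PowerSeries.constantCoeff (f : k⟦X⟧) = 0 := by
  rw [IsLocalRing.mem_maximalIdeal, mem_nonunits_iff, isUnit_semigroupRing_iff, not_not]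

theorem nonempty_residueField_semigroupRing_equiv :
    Nonempty (IsLocalRing.ResidueField (semigroupRing k S) ≃+* k) :=
  ⟨(Ideal.quotEquivOfEq (IsLocalRing.ker_eq_maximalIdeal (semigroupRing.residueMap k S)
    semigroupRing.residueMap_surjective).symm).trans
    (RingHom.quotientKerEquivOfSurjective semigroupRing.residueMap_surjective)⟩

/-- Up to a power, every element of the maximal ideal is divisible by a given nonzero `x`: the
quotient of a series of large order by `x` has all its exponents past the gaps of `S`. -/
theorem maximalIdeal_semigroupRing_le_radical (hS : ∃ c, ∀ i, c ≤ i → i ∈ S)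
    {x : semigroupRing k S} (hx : x ≠ 0) :
    IsLocalRing.maximalIdeal (semigroupRing k S) ≤ (Ideal.span {x}).radical := by
  intro f hf
  obtain ⟨c, hc⟩ := hS
  set e := (x : k⟦X⟧).order.toNat
  have hx' : (x : k⟦X⟧) ≠ 0 := fun h => hx (Subtype.ext h)
  rw [mem_maximalIdeal_semigroupRing_iff, ← PowerSeries.X_dvd_iff] at hf
  obtain ⟨h, hh⟩ := pow_dvd_pow_of_dvd hf (e + c)
  obtain ⟨g, hg⟩ := dvd_of_X_pow_dvd (fun i => PowerSeries.coeff_of_lt_order_toNat i)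
    (PowerSeries.coeff_order hx') (dvd_refl ((PowerSeries.X : k⟦X⟧) ^ e))
  have hgS : PowerSeries.X ^ c * (g * h) ∈ semigroupRing k S := by
    intro i hi
    rw [PowerSeries.coeff_X_pow_mul'] at hi
    exact hc i (of_not_not fun h => hi (if_neg h))
  refine ⟨e + c, Ideal.mem_span_singleton.mpr ⟨⟨_, hgS⟩, Subtype.ext ?_⟩⟩
  have : ((f ^ (e + c) : semigroupRing k S) : k⟦X⟧) = (f : k⟦X⟧) ^ (e + c) := rfl
  rw [this, hh, pow_add, hg, MulMemClass.coe_mul]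
  ring

theorem maximalIdeal_semigroupRing_fg (hS : ∃ c, ∀ i, c ≤ i → i ∈ S) :
    (IsLocalRing.maximalIdeal (semigroupRing k S)).FG := by
  obtain ⟨c, hc⟩ := hS
  have he : c + 1 ∈ (S : Set ℕ) \ {0} := ⟨hc _ (by omega), by simp⟩
  set G : Set (semigroupRing k S) :=
    {f | ∃ x ∈ (S : Set ℕ) \ {0}, x ≤ c + 1 + c ∧ (f : k⟦X⟧) = PowerSeries.X ^ x} with hG
  have hfin : G.Finite := by
    apply Set.Finite.of_finite_image (f := ((↑) : semigroupRing k S → k⟦X⟧)) _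
      Subtype.val_injective.injOn
    refine ((Set.finite_Iic (c + 1 + c)).image fun x => (PowerSeries.X : k⟦X⟧) ^ x).subset ?_
    rintro _ ⟨f, ⟨x, -, hx, hfx⟩, rfl⟩
    exact ⟨x, hx, hfx.symm⟩
  have : IsLocalRing.maximalIdeal (semigroupRing k S) = Ideal.span G := by
    apply le_antisymm
    · intro f hf
      rw [mem_maximalIdeal_semigroupRing_iff] at hf
      refine mem_span_of_coeff_ne_zero_mem Set.sdiff_subset hc he f fun i hi => ⟨f.2 i hi, ?_⟩
      rintro rfl
      exact hi (by rwa [PowerSeries.coeff_zero_eq_constantCoeff_apply])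
    · rw [Ideal.span_le]
      rintro f ⟨x, hx, -, hfx⟩
      rw [SetLike.mem_coe, mem_maximalIdeal_semigroupRing_iff, hfx, map_pow,
        PowerSeries.constantCoeff_X, zero_pow hx.2]
  rw [this]
  exact Submodule.fg_span hfin

theorem isNoetherianRing_semigroupRing (hS : ∃ c, ∀ i, c ≤ i → i ∈ S) :
    IsNoetherianRing (semigroupRing k S) := by
  -- a nonzero prime ideal is the maximal ideal
  refine IsNoetherianRing.of_prime_ne_bot fun P hP hP0 => ?_
  obtain ⟨x, hxP, hx⟩ := Submodule.exists_mem_ne_zero_of_ne_bot hP0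
  have : P = IsLocalRing.maximalIdeal (semigroupRing k S) :=
    le_antisymm (IsLocalRing.le_maximalIdeal hP.ne_top)
      ((maximalIdeal_semigroupRing_le_radical hS hx).trans
        (hP.radical_le_iff.mpr ((Ideal.span_singleton_le_iff_mem P).mpr hxP)))
  rw [this]
  exact maximalIdeal_semigroupRing_fg hS

theorem monomial_mem_nonZeroDivisors {i : ℕ} (hi : i ∈ S) :
    semigroupRing.monomial k hi ∈ nonZeroDivisors (semigroupRing k S) :=
  mem_nonZeroDivisors_of_ne_zero fun h =>
    pow_ne_zero i (PowerSeries.X_ne_zero (R := k)) (congrArg Subtype.val h)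

theorem monomial_mem_maximalIdeal {i : ℕ} (hi : i ∈ S) (h0 : i ≠ 0) :
    semigroupRing.monomial k hi ∈ IsLocalRing.maximalIdeal (semigroupRing k S) := by
  rw [mem_maximalIdeal_semigroupRing_iff, semigroupRing.coe_monomial, map_pow,
    PowerSeries.constantCoeff_X, zero_pow h0]

theorem ringKrullDim_semigroupRing (hS : ∃ c, ∀ i, c ≤ i → i ∈ S) :
    ringKrullDim (semigroupRing k S) = 1 := by
  rw [ringKrullDim_eq_one_iff_of_isLocalRing_isDomain]
  refine ⟨fun hF => ?_, fun x hx => maximalIdeal_semigroupRing_le_radical hS hx⟩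
  obtain ⟨c, hc⟩ := hS
  have hm := monomial_mem_maximalIdeal (k := k) (hc (c + 1) (by omega)) (by omega)
  rw [IsLocalRing.isField_iff_maximalIdeal_eq.mp hF, Ideal.mem_bot] at hm
  exact nonZeroDivisors.ne_zero (monomial_mem_nonZeroDivisors _) hm

end SemigroupRing

/-! ### The ideals `I_n` -/

section Family

variable {k : Type*} [Field k] {n : ℕ}

theorem levelSet_subset_semigroupS (hn : 3 ≤ n) (m : ℕ) : levelSet n m ⊆ semigroupS n := by
  rw [coe_semigroupS hn]
  exact levelSet_antitone n (Nat.zero_le m)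

theorem monomialIdeal_idealE_pow (hn : 3 ≤ n) (m : ℕ) :
    monomialIdeal k (semigroupS n) (idealE n) ^ m =
      monomialIdeal k (semigroupS n) (levelSet n m) := by
  induction m with
  | zero =>
    rw [pow_zero, Ideal.one_eq_top, eq_comm, Ideal.eq_top_iff_one]
    exact Ideal.subset_span ⟨0, by simpa using mul_two_mul_mem_levelSet hn 0, (pow_zero _).symm⟩
  | succ m ih =>
    rw [pow_succ, ih, idealE_eq_levelSet hn, monomialIdeal_mul
      (levelSet_subset_semigroupS hn m) (levelSet_subset_semigroupS hn 1), ← levelSet_succ]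

theorem mem_monomialIdeal_idealE_pow_iff (hn : 3 ≤ n) {m : ℕ}
    {f : semigroupRing k (semigroupS n)} :
    f ∈ monomialIdeal k (semigroupS n) (idealE n) ^ m ↔
      ∀ i, PowerSeries.coeff i (f : k⟦X⟧) ≠ 0 → i ∈ levelSet n m := by
  rw [monomialIdeal_idealE_pow hn]
  refine mem_monomialIdeal_iff ?_ (levelSet_subset_semigroupS hn m)
    (exists_forall_ge_mem_semigroupS hn) ⟨_, mul_two_mul_mem_levelSet hn m⟩
  rw [coe_semigroupS hn]
  rintro _ ⟨y, hy, z, hz, rfl⟩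
  exact add_mem_levelSet (j := 0) hy hz

theorem monomial_mem_monomialIdeal_idealE_pow (hn : 3 ≤ n) {m i : ℕ} (hi : i ∈ levelSet n m) :
    semigroupRing.monomial k (levelSet_subset_semigroupS hn m hi) ∈
      monomialIdeal k (semigroupS n) (idealE n) ^ m := by
  rw [monomialIdeal_idealE_pow hn]
  exact Ideal.subset_span ⟨i, hi, rfl⟩

theorem coeff_eq_zero_of_mem_monomialIdeal_idealE_pow (hn : 3 ≤ n) {m : ℕ}
    {f : semigroupRing k (semigroupS n)}
    (hf : f ∈ monomialIdeal k (semigroupS n) (idealE n) ^ m) {i : ℕ} (hi : i < m * (2 * n)) :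
    PowerSeries.coeff i (f : k⟦X⟧) = 0 := by
  by_contra h
  exact absurd (le_of_mem_levelSet hn ((mem_monomialIdeal_idealE_pow_iff hn).mp hf i h))
    (not_le.mpr hi)

/-- A principal reduction of `I_n` has order `2 * n`, the least exponent in `I_n`. -/
theorem IsPrincipalReduction.coeff_ne_zero (hn : 3 ≤ n) {x : semigroupRing k (semigroupS n)}
    (hx : IsPrincipalReduction (monomialIdeal k (semigroupS n) (idealE n)) x) :
    PowerSeries.coeff (2 * n) (x : k⟦X⟧) ≠ 0 := by
  obtain ⟨hxI, m, hm⟩ := hx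
  have h := monomial_mem_monomialIdeal_idealE_pow (k := k) hn (mul_two_mul_mem_levelSet hn (m + 1))
  rw [hm, Ideal.mem_span_singleton_mul] at h
  obtain ⟨y, hy, hxy⟩ := h
  have hxy' : (x : k⟦X⟧) * (y : k⟦X⟧) = PowerSeries.X ^ ((m + 1) * (2 * n)) :=
    congrArg Subtype.val hxy
  have h1 : PowerSeries.coeff ((m + 1) * (2 * n)) ((x : k⟦X⟧) * (y : k⟦X⟧)) ≠ 0 := by
    rw [hxy', PowerSeries.coeff_X_pow_self]
    exact one_ne_zero
  rw [PowerSeries.coeff_mul] at h1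
  obtain ⟨⟨i, j⟩, hij, hne⟩ := Finset.exists_ne_zero_of_sum_ne_zero h1
  rw [Finset.HasAntidiagonal.mem_antidiagonal] at hij
  dsimp only at hij hne
  have hi : 1 * (2 * n) ≤ i := by
    by_contra h
    refine left_ne_zero_of_mul hne
      (coeff_eq_zero_of_mem_monomialIdeal_idealE_pow hn (m := 1) ?_ (not_le.mp h))
    rwa [pow_one]
  have hj : m * (2 * n) ≤ j := by
    by_contra h
    exact right_ne_zero_of_mul hne
      (coeff_eq_zero_of_mem_monomialIdeal_idealE_pow hn hy (not_le.mp h))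
  rw [Nat.succ_mul] at hij
  have : i = 2 * n := by omega
  rw [← this]
  exact left_ne_zero_of_mul hne

theorem pow_succ_eq_span_singleton_mul_pow (hn : 3 ≤ n) {x : semigroupRing k (semigroupS n)}
    (hxI : x ∈ monomialIdeal k (semigroupS n) (idealE n))
    (hx : PowerSeries.coeff (2 * n) (x : k⟦X⟧) ≠ 0) {j : ℕ} (hj : n - 1 ≤ j) :
    monomialIdeal k (semigroupS n) (idealE n) ^ (j + 1) =
      Ideal.span {x} * monomialIdeal k (semigroupS n) (idealE n) ^ j := by
  have hxI1 : x ∈ monomialIdeal k (semigroupS n) (idealE n) ^ 1 := by rwa [pow_one]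
  apply le_antisymm
  · intro f hf
    have hlt : ∀ i < 2 * n, PowerSeries.coeff i (x : k⟦X⟧) = 0 := fun i hi =>
      coeff_eq_zero_of_mem_monomialIdeal_idealE_pow hn hxI1 (by rwa [one_mul])
    obtain ⟨g, hg⟩ := dvd_of_X_pow_dvd (f := (f : k⟦X⟧)) hlt hx
      (PowerSeries.X_pow_dvd_iff.mpr fun i hi =>
        coeff_eq_zero_of_mem_monomialIdeal_idealE_pow hn hf
          (hi.trans_le (Nat.le_mul_of_pos_left _ (Nat.succ_pos j))))
    have hgE : ∀ i, PowerSeries.coeff i g ≠ 0 → i ∈ levelSet n j := by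
      refine mem_of_coeff_ne_zero_of_mul hlt hx (fun i hi l hl => ?_) fun i hi => ?_
      · have hi' := (mem_monomialIdeal_idealE_pow_iff hn).mp hxI1 i hi
        rw [add_comm i l]
        exact exists_of_mem_levelSet_succ hn hj (add_mem_levelSet hl hi')
      · rw [← hg] at hi
        exact exists_of_mem_levelSet_succ hn hj ((mem_monomialIdeal_idealE_pow_iff hn).mp hf i hi)
    exact Ideal.mem_span_singleton_mul.mpr
      ⟨⟨g, fun i hi => levelSet_subset_semigroupS hn j (hgE i hi)⟩,
        (mem_monomialIdeal_idealE_pow_iff hn).mpr hgE, Subtype.ext hg.symm⟩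
  · rw [pow_succ']
    exact Ideal.mul_mono_left ((Ideal.span_singleton_le_iff_mem _).mpr hxI)

/-- For `j < n - 1` the monomial of exponent `(j + 1) * (4 * n - 1)` lies in `I_n ^ (j + 1)` but not
in `x I_n ^ j`. -/
theorem le_of_pow_succ_eq_span_singleton_mul_pow (hn : 3 ≤ n)
    {x : semigroupRing k (semigroupS n)}
    (hxI : x ∈ monomialIdeal k (semigroupS n) (idealE n))
    (hx : PowerSeries.coeff (2 * n) (x : k⟦X⟧) ≠ 0) {j : ℕ}
    (hj : monomialIdeal k (semigroupS n) (idealE n) ^ (j + 1) =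
      Ideal.span {x} * monomialIdeal k (semigroupS n) (idealE n) ^ j) : n - 1 ≤ j := by
  by_contra hlt
  have h := monomial_mem_monomialIdeal_idealE_pow (k := k) hn
    (mul_four_mul_sub_one_mem_levelSet hn j)
  rw [hj, Ideal.mem_span_singleton_mul] at h
  obtain ⟨y, hy, hxy⟩ := h
  have hxy' : (x : k⟦X⟧) * (y : k⟦X⟧) = PowerSeries.X ^ ((j + 1) * (4 * n - 1)) :=
    congrArg Subtype.val hxy
  have hy0 : (y : k⟦X⟧) ≠ 0 := by
    intro h0
    rw [h0, mul_zero] at hxy'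
    exact pow_ne_zero _ PowerSeries.X_ne_zero hxy'.symm
  have hox : (x : k⟦X⟧).order = (2 * n : ℕ) := by
    refine PowerSeries.order_eq_nat.mpr ⟨hx, fun i hi => ?_⟩
    refine coeff_eq_zero_of_mem_monomialIdeal_idealE_pow hn (m := 1) ?_ (by rwa [one_mul])
    rwa [pow_one]
  have ho := congrArg PowerSeries.order hxy'
  rw [PowerSeries.order_mul, PowerSeries.order_X_pow, hox,
    ← ENat.natCast_toNat (mt PowerSeries.order_eq_top.mp hy0)] at ho
  exact not_mem_levelSet_of_lt (not_le.mp hlt) (by exact_mod_cast ho)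
    ((mem_monomialIdeal_idealE_pow_iff hn).mp hy _ (PowerSeries.coeff_order hy0))

theorem hasReductionNumber_monomialIdeal_idealE (k : Type*) [Field k] (hn : 3 ≤ n) :
    HasReductionNumber (monomialIdeal k (semigroupS n) (idealE n)) (n - 1) := by
  constructor
  · have h := monomial_mem_monomialIdeal_idealE_pow (k := k) hn (two_mul_mem_levelSet hn)
    rw [pow_one] at h
    refine ⟨_, h, n - 1, pow_succ_eq_span_singleton_mul_pow hn h ?_ le_rfl⟩
    rw [semigroupRing.coe_monomial, PowerSeries.coeff_X_pow_self]
    exact one_ne_zero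
  · intro x hx
    exact ⟨pow_succ_eq_span_singleton_mul_pow hn hx.1 (hx.coeff_ne_zero hn) le_rfl,
      fun j hj => le_of_pow_succ_eq_span_singleton_mul_pow hn hx.1 (hx.coeff_ne_zero hn) hj⟩

theorem pow_eq_ratliffRush_pow (hn : 3 ≤ n) (m : ℕ) :
    monomialIdeal k (semigroupS n) (idealE n) ^ m =
      ratliffRush (monomialIdeal k (semigroupS n) (idealE n) ^ m) := by
  apply le_antisymm
  · intro f hf
    refine ⟨1, le_rfl, Submodule.mem_colon.mpr fun g hg => ?_⟩
    rw [pow_one] at hg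
    rw [pow_two, smul_eq_mul]
    exact Ideal.mul_mem_mul hf hg
  · rintro f ⟨l, -, hf⟩
    rw [mem_monomialIdeal_idealE_pow_iff hn]
    intro i hi
    have h := monomial_mem_monomialIdeal_idealE_pow (k := k) hn
      (mul_two_mul_mem_levelSet hn (m * l))
    rw [pow_mul] at h
    have h2 := Submodule.mem_colon.mp hf _ h
    rw [← pow_mul, smul_eq_mul, mul_add, mul_one, mem_monomialIdeal_idealE_pow_iff hn] at h2
    refine mem_levelSet_of_add_mul_mem hn ?_ (h2 (i + m * l * (2 * n)) ?_)
    · rw [← coe_semigroupS hn]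
      exact f.2 i hi
    · rwa [MulMemClass.coe_mul, semigroupRing.coe_monomial, PowerSeries.coeff_mul_X_pow]

theorem ratliffRushNumber_monomialIdeal_idealE (k : Type*) [Field k] (hn : 3 ≤ n) :
    ratliffRushNumber (monomialIdeal k (semigroupS n) (idealE n)) = 1 :=
  IsLeast.csInf_eq ⟨⟨le_rfl, fun m _ => pow_eq_ratliffRush_pow hn m⟩, fun _ h => h.1⟩

theorem finite_compl_semigroupS (hn : 3 ≤ n) : ((semigroupS n : Set ℕ)ᶜ).Finite := by
  obtain ⟨c, hc⟩ := exists_forall_ge_mem_semigroupS hn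
  exact (Set.finite_Iio c).subset fun i hi => not_le.mp fun h => hi (hc i h)

end Family

theorem mainTheorem6 (k : Type u) [Field k] :
    (∀ n : ℕ, 3 ≤ n →
      ((semigroupS n : Set ℕ)ᶜ).Finite ∧
      HasReductionNumber (monomialIdeal k (semigroupS n) (idealE n)) (n - 1) ∧
      ratliffRushNumber (monomialIdeal k (semigroupS n) (idealE n)) = 1) ∧
    (∀ N : ℕ, ∃ (R : Type u) (_ : CommRing R) (_ : IsLocalRing R) (I : Ideal R) (r : ℕ),
      IsNoetherianRing R ∧ ringKrullDim R = 1 ∧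
      (∃ y ∈ IsLocalRing.maximalIdeal R, y ∈ nonZeroDivisors R) ∧
      Nonempty (IsLocalRing.ResidueField R ≃+* k) ∧
      (∃ y ∈ I, y ∈ nonZeroDivisors R) ∧
      HasReductionNumber I r ∧ N ≤ r ∧ ratliffRushNumber I = 1) := by
  refine ⟨fun n hn => ⟨finite_compl_semigroupS hn, hasReductionNumber_monomialIdeal_idealE k hn,
    ratliffRushNumber_monomialIdeal_idealE k hn⟩, fun N => ?_⟩
  have hn : 3 ≤ N + 3 := by omega
  have hS := exists_forall_ge_mem_semigroupS hn
  have hI := monomial_mem_monomialIdeal_idealE_pow (k := k) hn (two_mul_mem_levelSet hn)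
  rw [pow_one] at hI
  exact ⟨semigroupRing k (semigroupS (N + 3)), inferInstance, inferInstance,
    monomialIdeal k (semigroupS (N + 3)) (idealE (N + 3)), N + 3 - 1,
    isNoetherianRing_semigroupRing hS, ringKrullDim_semigroupRing hS,
    ⟨_, monomial_mem_maximalIdeal (mem_semigroupS_of_mem (by simp)) (i := 2 * (N + 3)) (by omega),
      monomial_mem_nonZeroDivisors _⟩,
    nonempty_residueField_semigroupRing_equiv, ⟨_, hI, monomial_mem_nonZeroDivisors _⟩,
    hasReductionNumber_monomialIdeal_idealE k hn, by omega,
    ratliffRushNumber_monomialIdeal_idealE k hn⟩
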